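/- Let $\mathbb F_q$ be a finite field of odd characteristic, let $(V,\omega)$ be a symplectic vector space of dimension $2n$ over $\mathbb F_q$, and let $\psi:\mathbb F_q\to\mathbb C^\times$ be a non-trivial additive character. Let $H(V)=V\times\mathbb F_q$ be the Heisenberg group, with multiplication $(v,z)\cdot(v',z')=(v+v',\,z+z'+\tfrac12\omega(v,v'))$; identify $v\in V$ with $(v,0)$ and $z\in\mathbb F_q$ with $(0,z)$. An oriented Lagrangian is a pair $L^\circ=(L,o_L)$ with $L\subset V$ a Lagrangian subspace and $o_L\in\bigwedge^{n}L$ a non-zero vector; $OLag(V)$ is the set of all of them. For $L^\circ\in OLag(V)$ let $\mathcal H_{L^\circ}$ be the space of functions $f:H(V)\to\mathbb C$ such that $f(z\cdot h)=\psi(z)f(h)$ and $f(l\cdot h)=f(h)$ for all $z\in\mathbb F_q$, $l\in L$, $h\in H(V)$, on which $H(V)$ acts by right translation, $(\pi_{L^\circ}(h)f)(h')=f(h'\cdot h)$. Let $\mathfrak H$ be the bundle on $OLag(V)$ with fibres $\mathcal H_{L^\circ}$. A trivialization of $\mathfrak H$ is a system of isomorphisms of $H(V)$-representations $E_{M^\circ,L^\circ}:\mathcal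 H_{L^\circ}\to\mathcal H_{M^\circ}$, for $(M^\circ,L^\circ)\in OLag(V)^2$, such that $E_{N^\circ,M^\circ}\circ E_{M^\circ,L^\circ}=E_{N^\circ,L^\circ}$ for all $N^\circ,M^\circ,L^\circ\in OLag(V)$. For $(M^\circ,L^\circ)\in OLag(V)^2$ with $M+L=V$ let $T_{M^\circ,L^\circ}=A_{M^\circ,L^\circ}\cdot F_{M^\circ,L^\circ}:\mathcal H_{L^\circ}\to\mathcal H_{M^\circ}$, where $$F_{M^\circ,L^\circ}[f](h)=\sum_{m\in M}f(m\cdot h),\qquad A_{M^\circ,L^\circ}=\left(\frac{G_1}{q}\right)^{n}\sigma\!\left((-1)^{\binom n2}\,\omega_\wedge(o_L,o_M)\right),\qquad G_1=\sum_{z\in\mathbb F_q}\psi(\tfrac12z^2).$$ Here $\sigma$ is the quadratic character of $\mathbb F_q^\times$ and $\omega_\wedge:\bigwedge^{n}L\times\bigwedge^{n}M\to\mathbb F_q$ is the bilinear pairing with $\omega_\wedge(e_1\wedge\dots\wedge e_n,\,f_1\wedge\dots\wedge f_n)=\det\big(\omega(e_i,f_{n+1-j})\big)_{i,j}=(-1)^{\binom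 n2}\det\big(\omega(e_i,f_j)\big)_{i,j}$. Then there is exactly one trivialization of $\mathfrak H$ whose member at $(M^\circ,L^\circ)$ is $T_{M^\circ,L^\circ}$ for every pair $(M^\circ,L^\circ)\in OLag(V)^2$ with $M+L=V$. -/

import Mathlib

noncomputable section

namespace SvN

variable {F V : Type*} [Field F] [AddCommGroup V] [Module F V]

/-- The Heisenberg group attached to `(V, ω)`: the set `V × F`. -/
@[ext]
structure Heisenberg (ω : LinearMap.BilinForm F V) where
  vec : V
  cen : F

namespace Heisenberg

variable {ω : LinearMap.BilinForm F V}

/-- `(v, z) * (v', z') = (v + v', z + z' + ω(v, v') / 2)`. -/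
instance : Mul (Heisenberg ω) :=
  ⟨fun a b => ⟨a.vec + b.vec, a.cen + b.cen + 2⁻¹ * ω a.vec b.vec⟩⟩

instance : One (Heisenberg ω) := ⟨⟨0, 0⟩⟩

/-- For an alternating form this is `(v, z)⁻¹ = (-v, -z)`. -/
instance : Inv (Heisenberg ω) :=
  ⟨fun a => ⟨-a.vec, -a.cen + 2⁻¹ * ω a.vec a.vec⟩⟩

@[simp] theorem mul_vec (a b : Heisenberg ω) : (a * b).vec = a.vec + b.vec := rfl
@[simp] theorem mul_cen (a b : Heisenberg ω) :
    (a * b).cen = a.cen + b.cen + 2⁻¹ * ω a.vec b.vec := rfl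
@[simp] theorem one_vec : (1 : Heisenberg ω).vec = 0 := rfl
@[simp] theorem one_cen : (1 : Heisenberg ω).cen = 0 := rfl
@[simp] theorem inv_vec (a : Heisenberg ω) : (a⁻¹).vec = -a.vec := rfl
@[simp] theorem inv_cen (a : Heisenberg ω) :
    (a⁻¹).cen = -a.cen + 2⁻¹ * ω a.vec a.vec := rfl

instance : Group (Heisenberg ω) :=
  Group.ofLeftAxioms
    (by
      intro a b c
      ext
      · simp [add_assoc]
      · simp only [mul_vec, mul_cen, map_add, LinearMap.add_apply]
        ring)
    (by intro a; ext <;> simp)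
    (by intro a; ext <;> simp)

variable (ω) in
/-- The embedding `v ↦ (v, 0)` of the set `V`. -/
def ofVec (v : V) : Heisenberg ω := ⟨v, 0⟩

variable (ω) in
/-- The central embedding `z ↦ (0, z)`. -/
def ofCen (z : F) : Heisenberg ω := ⟨0, z⟩

theorem ofCen_mul_comm (z : F) (h : Heisenberg ω) : ofCen ω z * h = h * ofCen ω z := by
  ext <;> simp [ofCen, add_comm]

end Heisenberg

open Heisenberg

/-- A Lagrangian subspace is one which is equal to its own orthogonal complement. -/
def IsLagrangian (ω : LinearMap.BilinForm F V) (L : Submodule F V) : Prop :=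
  ω.orthogonal L = L

theorem IsLagrangian.apply_eq_zero {ω : LinearMap.BilinForm F V} {L : Submodule F V}
    (hL : IsLagrangian ω L) {l l' : V} (h : l ∈ L) (h' : l' ∈ L) : ω l l' = 0 := by
  have h2 : l' ∈ ω.orthogonal L := by
    rw [hL]
    exact h'
  exact h2 l h

theorem IsLagrangian.ofVec_mul {ω : LinearMap.BilinForm F V} {L : Submodule F V}
    (hL : IsLagrangian ω L) {l l' : V} (h : l ∈ L) (h' : l' ∈ L) :
    ofVec ω l * ofVec ω l' = ofVec ω (l + l') := by
  ext <;> simp [ofVec, hL.apply_eq_zero h h']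

/-- An oriented Lagrangian subspace of a `2n`-dimensional symplectic space: a Lagrangian subspace
`L` with a non-zero element of its `n`-th exterior power, which is the top exterior power since
`L` is of dimension `n`. -/
structure OLag (ω : LinearMap.BilinForm F V) (n : ℕ) where
  space : Submodule F V
  isLagrangian : IsLagrangian ω space
  orient : ⋀[F]^n space
  orient_ne_zero : orient ≠ 0

/-- The pairing `⋀ⁿ L × ⋀ⁿ M → F` induced by `ω`, with adjacent vectors of the word
`e₁ ∧ ⋯ ∧ eₙ, f₁ ∧ ⋯ ∧ fₙ` paired first. It takes this pair to
`det (ω(eᵢ, f_{n+1-j})) = (-1) ^ (n choose 2) * det (ω(eᵢ, fⱼ))`; see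
`wedgePairing_ιMulti` and `wedgePairing_ιMulti_rev`. -/
def wedgePairing (ω : LinearMap.BilinForm F V) (n : ℕ) (L M : Submodule F V) :
    ⋀[F]^n L →ₗ[F] ⋀[F]^n M →ₗ[F] F :=
  (-1 : F) ^ n.choose 2 •
    (exteriorPower.pairingDual F M n ∘ₗ exteriorPower.map n (ω.domRestrict₁₂ L M))

theorem wedgePairing_ιMulti (ω : LinearMap.BilinForm F V) (n : ℕ) (L M : Submodule F V)
    (e : Fin n → L) (f : Fin n → M) :
    wedgePairing ω n L M (exteriorPower.ιMulti F n e) (exteriorPower.ιMulti F n f) =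
      (-1 : F) ^ n.choose 2 * (Matrix.of fun i j => ω (e i) (f j)).det := by
  rw [← Matrix.det_transpose]
  simp only [wedgePairing, LinearMap.smul_apply, LinearMap.comp_apply, smul_eq_mul,
    exteriorPower.map_apply_ιMulti, exteriorPower.pairingDual_ιMulti_ιMulti]
  rfl

theorem wedgePairing_ιMulti_rev (ω : LinearMap.BilinForm F V) (n : ℕ) (L M : Submodule F V)
    (e : Fin n → L) (f : Fin n → M) :
    wedgePairing ω n L M (exteriorPower.ιMulti F n e) (exteriorPower.ιMulti F n f) =
      (Matrix.of fun i j : Fin n => ω (e i) (f j.rev)).det := by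
  have hs : Equiv.Perm.sign (Fin.revPerm (n := n)) = (-1) ^ n.choose 2 := by
    rw [Equiv.Perm.sign_eq_prod_prod_Iio,
      Finset.prod_congr rfl (g := fun j : Fin n => (-1 : ℤˣ) ^ (j : ℕ)), Finset.prod_pow_eq_pow_sum,
      Fin.sum_univ_eq_sum_range (fun i => i) n, Finset.sum_range_id, Nat.choose_two_right]
    intro j _
    rw [Finset.prod_congr rfl (g := fun _ => (-1 : ℤˣ)), Finset.prod_const, Fin.card_Iio]
    intro i hi
    have hij : i < j := Finset.mem_Iio.1 hi
    simp [Fin.rev_lt_rev, hij.le]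
  have h := Matrix.det_permute' (Fin.revPerm (n := n)) (Matrix.of fun i j => ω (e i) (f j))
  rw [hs] at h
  rw [wedgePairing_ιMulti]
  refine Eq.trans ?_ h.symm
  simp

variable {ω : LinearMap.BilinForm F V} {n : ℕ}

/-- The space `𝓗_L` of functions `f` on the Heisenberg group with `f(z · h) = ψ(z) f(h)` for
central `z` and `f(l · h) = f(h)` for `l ∈ L`. -/
def model (ψ : AddChar F ℂ) (L : OLag ω n) : Submodule ℂ (Heisenberg ω → ℂ) where
  carrier := {f | (∀ (z : F) (h : Heisenberg ω), f (ofCen ω z * h) = ψ z * f h) ∧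
    ∀ l ∈ L.space, ∀ h : Heisenberg ω, f (ofVec ω l * h) = f h}
  zero_mem' := by simp
  add_mem' := by
    rintro f g ⟨hf, hf'⟩ ⟨hg, hg'⟩
    refine ⟨fun z h => ?_, fun l hl h => ?_⟩
    · simp [hf, hg, mul_add]
    · simp [hf' l hl, hg' l hl]
  smul_mem' := by
    rintro c f ⟨hf, hf'⟩
    refine ⟨fun z h => ?_, fun l hl h => ?_⟩
    · simp [hf, mul_left_comm]
    · simp [hf' l hl]

/-- The Heisenberg action on `𝓗_L` by right translation, `(π(h) f)(h') = f(h' · h)`. -/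
def modelRep (ψ : AddChar F ℂ) (L : OLag ω n) :
    Representation ℂ (Heisenberg ω) (model ψ L) where
  toFun h :=
    { toFun := fun f => ⟨fun h' => f.1 (h' * h),
        fun z h' => by beta_reduce; rw [mul_assoc, f.2.1],
        fun l hl h' => by beta_reduce; rw [mul_assoc, f.2.2 l hl]⟩
      map_add' := fun _ _ => rfl
      map_smul' := fun _ _ => rfl }
  map_one' := by ext; simp
  map_mul' := by intros; ext; simp [mul_assoc]

@[simp] theorem modelRep_apply (ψ : AddChar F ℂ) (L : OLag ω n) (h h' : Heisenberg ω)
    (f : model ψ L) : (modelRep ψ L h f).1 h' = f.1 (h' * h) := rfl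

/-- A trivialization of a bundle over `X` with fibres `E x` on which a group `G` acts fibrewise: a
system of intertwining isomorphisms `T y x : E x → E y` with `T z y ∘ T y x = T z x`. -/
structure IsTrivialization {X G : Type*} [Group G] {E : X → Type*} [∀ x, AddCommGroup (E x)]
    [∀ x, Module ℂ (E x)] {ρ : ∀ x, Representation ℂ G (E x)}
    (T : ∀ y x, (ρ x).IntertwiningMap (ρ y)) : Prop where
  bijective : ∀ y x, Function.Bijective (T y x)
  comp : ∀ z y x, (T z y).comp (T y x) = T z x

variable [Fintype F] [FiniteDimensional F V]

/-- The averaging morphism `F_{M,L} : 𝓗_L → 𝓗_M`, `F_{M,L}[f](h) = ∑_{m ∈ M} f(m · h)`.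
(The sum is over a finite set.) -/
def averaging (ψ : AddChar F ℂ) (M L : OLag ω n) :
    (modelRep ψ L).IntertwiningMap (modelRep ψ M) where
  toFun f := ⟨fun h => ∑ᶠ m : M.space, f.1 (ofVec ω m * h), by
    refine ⟨fun z h => ?_, fun m₀ hm₀ h => ?_⟩
    · beta_reduce
      rw [← smul_eq_mul (ψ z), smul_finsum]
      refine finsum_congr fun m => ?_
      rw [← mul_assoc, ← ofCen_mul_comm, mul_assoc, f.2.1, smul_eq_mul]
    · beta_reduce
      rw [← finsum_comp_equiv (Equiv.addRight (⟨m₀, hm₀⟩ : M.space))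
        (f := fun m : M.space => f.1 (ofVec ω m * h))]
      refine finsum_congr fun m => ?_
      rw [← mul_assoc, M.isLagrangian.ofVec_mul m.2 hm₀]
      rfl⟩
  map_add' f g := by
    have : Finite V := Module.finite_of_finite F
    ext h
    exact finsum_add_distrib (Set.toFinite _) (Set.toFinite _)
  map_smul' c f := by
    ext h
    exact (smul_finsum c _).symm
  isIntertwining' g := by
    ext f h
    simp [mul_assoc]

/-- The one-dimensional Gauss sum `G₁ = ∑_z ψ(z² / 2)`. -/
def gaussSum₁ (ψ : AddChar F ℂ) : ℂ := ∑ z : F, ψ (2⁻¹ * z ^ 2)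

variable [DecidableEq F]

/-- `A_{M,L} = (G₁ / q) ^ n * σ((-1) ^ (n choose 2) * ω_∧(o_L, o_M))`. -/
def normalization (ψ : AddChar F ℂ) (M L : OLag ω n) : ℂ :=
  (gaussSum₁ ψ / Fintype.card F) ^ n *
    (quadraticChar F ((-1) ^ n.choose 2 *
      wedgePairing ω n L.space M.space L.orient M.orient) : ℤ)

/-- The morphism `T_{M,L} = A_{M,L} • F_{M,L}`, which is of interest when `M + L = V`. -/
def ansatz (ψ : AddChar F ℂ) (M L : OLag ω n) :
    (modelRep ψ L).IntertwiningMap (modelRep ψ M) :=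
  normalization ψ M L • averaging ψ M L

end SvN

end

noncomputable section

namespace SvN

open Matrix Module Heisenberg

/-! ### Gauss sums of quadratic forms -/

section GaussSums

variable {F : Type*} [Field F] [Fintype F] [DecidableEq F]

/-! Any two Lagrangians `M`, `L` have a common transversal `N`, so a trivialization must send the
pair to `T_{M,N} ∘ T_{N,L}`; this gives uniqueness. For existence, take that composite as a
definition and show that it does not depend on `N`.

By `averaging_comp`, `F_{M,N} ∘ F_{N,L}` is a multiple of `F_{M,L}`. The scalar is a sum over `v ∈
N`; only `v ∈ (L ∩ M)^⊥ = L + M` contribute, and there the summand is `ψ` of a quadratic form. In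
bases of `L` and `M` sharing a basis of `L ∩ M`, with the basis of `N` dual to that of `L`, the form
has a nondegenerate symmetric matrix `a` (`exists_symm_matrix`), and the sum is `σ(det (-a))` times
a power of `G₁`. In `ansatz_comp` the normalizations contribute `σ(det a)` once more and the
orientation of `N` twice, so every trace of `N` cancels. The same formula gives `T_{M,N} ∘ T_{N,L} =
T_{M,L}` for pairwise transversal triples, and the identity when `M = L`.

To pass from transversal triples to all triples, a Lagrangian transversal to `M`, `N` and `P` is
needed, where `M` and `N` are transversal (`IsLagrangian.exists_common_transversal`). Lagrangians
transversal to `M` are described by symmetric forms on `N`, and the conditions at `N` and `P` reduce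
to avoiding two values for each diagonal entry, which three field elements allow. -/

theorem gaussSum₁_eq_gaussSum (hF : ringChar F ≠ 2) {ψ : AddChar F ℂ} (hψ : ψ ≠ 1) {d : F}
    (hd : d ≠ 0) : ∑ z : F, ψ (d * z ^ 2) =
      gaussSum ((quadraticChar F).ringHomComp (Int.castRingHom ℂ)) (ψ.mulShift d) := by
  -- Group the terms by `a = z²`: there are `σ(a) + 1` square roots of `a`, and the constant `1`
  -- contributes a vanishing character sum.
  have h1 : ∑ z : F, ψ (d * z ^ 2) =
      ∑ a : F, ((quadraticChar F a : ℤ) + 1 : ℂ) * ψ (d * a) := by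
    rw [← Finset.sum_fiberwise (s := Finset.univ) (g := fun z : F => z ^ 2)]
    refine Finset.sum_congr rfl fun a _ => ?_
    rw [Finset.sum_congr rfl (g := fun _ => ψ (d * a)), Finset.sum_const, nsmul_eq_mul]
    · have h := quadraticChar_card_sqrts hF a
      rw [Set.toFinset_ofPred] at h
      have h' := congrArg (Int.cast : ℤ → ℂ) h
      push_cast at h'
      rw [← h']
    · intro z hz
      rw [(Finset.mem_filter.1 hz).2]
  have h2 : ∑ a : F, ψ (d * a) = 0 := by
    have h := AddChar.sum_mulShift d (AddChar.IsPrimitive.of_ne_one hψ)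
    simpa [hd, mul_comm] using h
  rw [h1]
  simp only [add_mul, Finset.sum_add_distrib, one_mul, h2, add_zero, gaussSum]
  rfl

/-- `∑_z ψ(d z² / 2) = σ(d) G₁`. -/
theorem sum_smul_sq (hF : ringChar F ≠ 2) {ψ : AddChar F ℂ} (hψ : ψ ≠ 1) {d : F} (hd : d ≠ 0) :
    ∑ z : F, ψ (2⁻¹ * (d * z ^ 2)) = (quadraticChar F d : ℤ) * gaussSum₁ ψ := by
  have h2 : (2 : F) ≠ 0 := Ring.two_ne_zero hF
  simp_rw [gaussSum₁, ← mul_assoc]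
  rw [gaussSum₁_eq_gaussSum hF hψ (mul_ne_zero (inv_ne_zero h2) hd),
    gaussSum₁_eq_gaussSum hF hψ (inv_ne_zero h2),
    ← gaussSum_mulShift _ (ψ.mulShift 2⁻¹) (Units.mk0 d hd)]
  have h : ψ.mulShift (2⁻¹ * d) = (ψ.mulShift 2⁻¹).mulShift d := by
    ext x
    simp [AddChar.mulShift_apply, mul_assoc]
  rw [h, Units.val_mk0, ← mul_assoc]
  have h1 : (quadraticChar F d : ℤ) * (quadraticChar F d : ℤ) = 1 := by
    rw [← sq, quadraticChar_sq_one hd]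
  have h1' : ((quadraticChar F d : ℤ) : ℂ) * (quadraticChar F d : ℤ) = 1 := mod_cast h1
  simp only [MulChar.ringHomComp_apply, eq_intCast]
  rw [h1', one_mul]

theorem gaussSum₁_sq (hF : ringChar F ≠ 2) {ψ : AddChar F ℂ} (hψ : ψ ≠ 1) :
    gaussSum₁ ψ ^ 2 = (quadraticChar F (-1) : ℤ) * Fintype.card F := by
  have h2 : (2 : F) ≠ 0 := Ring.two_ne_zero hF
  have hi : Function.Injective (Int.castRingHom ℂ) := Int.cast_injective
  rw [gaussSum₁, gaussSum₁_eq_gaussSum hF hψ (inv_ne_zero h2), gaussSum_sq]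
  · simp [MulChar.ringHomComp_apply]
  · exact (MulChar.ringHomComp_ne_one_iff hi).2 (quadraticChar_ne_one hF)
  · exact (quadraticChar_isQuadratic F).comp _
  · refine AddChar.IsPrimitive.of_ne_one ?_
    intro h
    exact AddChar.IsPrimitive.of_ne_one hψ (inv_ne_zero h2) h

/-- The Gauss sum of a nondegenerate quadratic form. -/
theorem sum_quadratic_form (hF : ringChar F ≠ 2) {ψ : AddChar F ℂ} (hψ : ψ ≠ 1)
    {ι : Type*} [Fintype ι] [DecidableEq ι] (a : Matrix ι ι F) (ha : a.IsSymm) (hd : a.det ≠ 0) :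
    ∑ x : ι → F, ψ (2⁻¹ * (x ⬝ᵥ a *ᵥ x)) =
      (quadraticChar F a.det : ℤ) * gaussSum₁ ψ ^ Fintype.card ι := by
  have h2 : (2 : F) ≠ 0 := Ring.two_ne_zero hF
  have := invertibleOfNonzero h2
  have hsymm : LinearMap.IsSymm (Matrix.toBilin' a) := by
    refine ⟨fun x y => ?_⟩
    simp only [Matrix.toBilin'_apply', RingHom.id_apply]
    rw [Matrix.dotProduct_mulVec, ← Matrix.mulVec_transpose, ha, dotProduct_comm]
  obtain ⟨v₀, hv₀⟩ := LinearMap.BilinForm.exists_orthogonal_basis hsymm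
  let v : Module.Basis ι F (ι → F) :=
    v₀.reindex (finCongr (by simp) |>.trans (Fintype.equivFin ι).symm)
  have hv : ∀ i j, i ≠ j → Matrix.toBilin' a (v i) (v j) = 0 := by
    intro i j hij
    simp only [v, Module.Basis.reindex_apply]
    exact hv₀ (fun h => hij (Equiv.injective _ h))
  let d : ι → F := fun i => Matrix.toBilin' a (v i) (v i)
  have hmat : LinearMap.BilinForm.toMatrix v (Matrix.toBilin' a) = Matrix.diagonal d := by
    ext i j
    rw [LinearMap.BilinForm.toMatrix_apply]
    by_cases h : i = j
    · subst h; simp [d]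
    · rw [hv i j h, Matrix.diagonal_apply_ne _ h]
  let P := (Pi.basisFun F ι).toMatrix v
  have hP : P.det ≠ 0 := by
    have := (Pi.basisFun F ι).isUnit_det v
    rw [Module.Basis.det_apply] at this
    exact this.ne_zero
  -- The discriminant changes by a square under a change of basis, so `σ` does not see the
  -- diagonalization.
  have hdet : ∏ i, d i = P.det ^ 2 * a.det := by
    have h := LinearMap.BilinForm.toMatrix_mul_basis_toMatrix (b := Pi.basisFun F ι) v
      (Matrix.toBilin' a)
    rw [hmat] at h
    have h' := congrArg Matrix.det h
    rw [Matrix.det_diagonal, Matrix.det_mul, Matrix.det_mul, Matrix.det_transpose,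
      LinearMap.BilinForm.toMatrix_basisFun, LinearMap.BilinForm.toMatrix'_toBilin'] at h'
    rw [← h']
    ring
  have hd0 : ∀ i, d i ≠ 0 := by
    intro i hi
    have : ∏ i, d i = 0 := Finset.prod_eq_zero (Finset.mem_univ i) hi
    rw [hdet] at this
    exact mul_ne_zero (pow_ne_zero 2 hP) hd this
  have hσ : quadraticChar F a.det = ∏ i, quadraticChar F (d i) := by
    rw [← map_prod, hdet, map_mul, map_pow, quadraticChar_sq_one hP, one_mul]
  rw [← Equiv.sum_comp v.equivFun.symm.toEquiv]
  have hexp : ∀ y : ι → F, ψ (2⁻¹ * ((v.equivFun.symm y) ⬝ᵥ a *ᵥ (v.equivFun.symm y))) =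
      ∏ i, ψ (2⁻¹ * (d i * y i ^ 2)) := by
    intro y
    have hp : ∏ i, ψ (2⁻¹ * (d i * y i ^ 2)) = ψ (∑ i, 2⁻¹ * (d i * y i ^ 2)) :=
      (map_prod ψ.toMonoidHom (fun i => Multiplicative.ofAdd (2⁻¹ * (d i * y i ^ 2)))
        Finset.univ).symm
    rw [hp, ← Finset.mul_sum, ← Matrix.toBilin'_apply',
      Module.Basis.equivFun_symm_apply]
    congr 2
    simp only [map_sum, LinearMap.sum_apply, map_smul, LinearMap.smul_apply, smul_eq_mul]
    refine Finset.sum_congr rfl fun i _ => ?_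
    rw [Finset.sum_eq_single i]
    · simp only [d]; ring
    · intro j _ hji
      rw [hv _ _ hji]; simp
    · simp
  simp only [LinearEquiv.coe_toEquiv, hexp]
  rw [← Fintype.piFinset_univ, ← Finset.prod_univ_sum (fun _ => Finset.univ)
    (fun i z => ψ (2⁻¹ * (d i * z ^ 2)))]
  simp only [sum_smul_sq hF hψ (hd0 _), Finset.prod_mul_distrib, Finset.prod_const,
    Finset.card_univ, hσ]
  push_cast
  rfl

end GaussSums

/-! ### Lagrangian subspaces and adapted bases -/

section Lagrangians

variable {F V : Type*} [Field F] [AddCommGroup V] [Module F V]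

theorem exists_basis_sum_extending [FiniteDimensional F V] {K L : Submodule F V} (hKL : K ≤ L)
    {ι κ : Type*} [Fintype ι] [Fintype κ] (b : Basis κ F K)
    (hcard : Fintype.card ι + Fintype.card κ = finrank F L) :
    ∃ e : Basis (ι ⊕ κ) F L, ∀ k, (e (Sum.inr k) : V) = b k := by
  obtain ⟨C, hC⟩ := Submodule.exists_isCompl (K.submoduleOf L)
  have hK : finrank F (K.submoduleOf L) = Fintype.card κ := by
    rw [(Submodule.submoduleOfEquivOfLe hKL).finrank_eq, finrank_eq_card_basis b]
  have hCd : finrank F C = Fintype.card ι := by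
    have := Submodule.finrank_add_eq_of_isCompl hC
    omega
  let c : Basis ι F C :=
    (finBasisOfFinrankEq F C hCd).reindex (Fintype.equivFin ι).symm
  refine ⟨(c.prod (b.map (Submodule.submoduleOfEquivOfLe hKL).symm)).map
    (Submodule.prodEquivOfIsCompl _ _ hC.symm), fun k => ?_⟩
  simp [Submodule.submoduleOfEquivOfLe]

variable {ω : LinearMap.BilinForm F V} {L M N : Submodule F V}

theorem IsLagrangian.mem_of_forall (hL : IsLagrangian ω L) {v : V} (h : ∀ l ∈ L, ω l v = 0) :
    v ∈ L := by
  rw [← hL]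
  exact h

theorem IsLagrangian.mem_iff_basis (hL : IsLagrangian ω L) {ι : Type*} (e : Basis ι F L) {v : V} :
    v ∈ L ↔ ∀ i, ω (e i) v = 0 := by
  refine ⟨fun h i => hL.apply_eq_zero (e i).2 h, fun h => hL.mem_of_forall fun l hl => ?_⟩
  have h0 : (ω.flip v) ∘ₗ L.subtype = 0 := e.ext fun i => by simpa using h i
  simpa using LinearMap.congr_fun h0 ⟨l, hl⟩

/-- A kernel vector would give an element of `N` orthogonal to `L`, hence lying in `L ⊓ N`. -/
theorem IsLagrangian.det_ne_zero (hL : IsLagrangian ω L) (hLN : L ⊓ N = ⊥) {ι : Type*}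
    [Fintype ι] [DecidableEq ι] (e : Basis ι F L)
    (f : Basis ι F N) : (Matrix.of fun i j => ω (e i) (f j)).det ≠ 0 := by
  intro h
  obtain ⟨v, hv, hv0⟩ := Matrix.exists_mulVec_eq_zero_iff.2 h
  have hmem : ((∑ j, v j • f j : N) : V) ∈ L := by
    refine (hL.mem_iff_basis e).2 fun i => ?_
    have := congrFun hv0 i
    simpa [Matrix.mulVec, dotProduct, mul_comm] using this
  have hz : (∑ j, v j • f j : N) = 0 := by
    have : ((∑ j, v j • f j : N) : V) ∈ L ⊓ N := ⟨hmem, Submodule.coe_mem _⟩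
    rw [hLN] at this
    exact Subtype.ext this
  exact hv (funext fun j => Fintype.linearIndependent_iff.1 f.linearIndependent v hz j)

theorem IsLagrangian.orthogonal_inf [FiniteDimensional F V] (hω : ω.IsAlt)
    (hnd : ω.Nondegenerate) (hL : IsLagrangian ω L) (hM : IsLagrangian ω M) :
    ω.orthogonal (L ⊓ M) = L ⊔ M := by
  have h1 : ω.orthogonal (L ⊔ M) = L ⊓ M := by
    refine le_antisymm (le_inf ?_ ?_) fun v hv w hw => ?_
    · exact (LinearMap.BilinForm.orthogonal_le le_sup_left).trans hL.le
    · exact (LinearMap.BilinForm.orthogonal_le le_sup_right).trans hM.le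
    · obtain ⟨l, hl, m, hm, rfl⟩ := Submodule.mem_sup.1 hw
      show ω (l + m) v = 0
      rw [map_add, LinearMap.add_apply, hL.apply_eq_zero hl hv.1, hM.apply_eq_zero hm hv.2,
        add_zero]
  rw [← h1, LinearMap.BilinForm.orthogonal_orthogonal hnd hω.isRefl]

section Symplectic

variable [FiniteDimensional F V] (hnd : ω.Nondegenerate) {n : ℕ}
  (hn : finrank F V = 2 * n)
include hnd hn

theorem IsLagrangian.finrank_eq (hL : IsLagrangian ω L) : finrank F L = n := by
  have h := LinearMap.BilinForm.finrank_orthogonal hnd L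
  rw [hL] at h
  have := Submodule.finrank_le L
  omega

theorem IsLagrangian.sup_eq_top_iff (hL : IsLagrangian ω L) (hM : IsLagrangian ω M) :
    L ⊔ M = ⊤ ↔ L ⊓ M = ⊥ := by
  have h := Submodule.finrank_sup_add_finrank_inf_eq L M
  rw [hL.finrank_eq hnd hn, hM.finrank_eq hnd hn] at h
  constructor
  · intro ht
    rw [ht, finrank_top] at h
    exact Submodule.finrank_eq_zero.1 (by omega)
  · intro hb
    rw [hb, finrank_bot] at h
    exact Submodule.eq_top_of_finrank_eq (by omega)

/-- Transversal Lagrangians are dual to each other. -/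
theorem IsLagrangian.exists_dual_basis (hL : IsLagrangian ω L) (hN : IsLagrangian ω N)
    (hLN : L ⊓ N = ⊥) {ι : Type*} [Fintype ι] [DecidableEq ι] (e : Basis ι F L) :
    ∃ f : Basis ι F N, ∀ i j, ω (e i) (f j) = if i = j then 1 else 0 := by
  let Φ : N →ₗ[F] (ι → F) := LinearMap.pi fun i => (ω (e i)) ∘ₗ N.subtype
  have hinj : Function.Injective Φ := by
    rw [← LinearMap.ker_eq_bot, LinearMap.ker_eq_bot']
    intro v hv
    have hvL : (v : V) ∈ L := (hL.mem_iff_basis e).2 fun i => congrFun hv i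
    have : (v : V) ∈ L ⊓ N := ⟨hvL, v.2⟩
    rw [hLN] at this
    exact Subtype.ext this
  have hdim : finrank F N = finrank F (ι → F) := by
    rw [hN.finrank_eq hnd hn, ← hL.finrank_eq hnd hn, finrank_eq_card_basis e]
    simp
  let E : N ≃ₗ[F] (ι → F) := LinearEquiv.ofInjectiveOfFinrankEq Φ hinj hdim
  refine ⟨(Pi.basisFun F ι).map E.symm, fun i j => ?_⟩
  have h : E (E.symm (Pi.basisFun F ι j)) = Pi.basisFun F ι j := E.apply_symm_apply _
  have h' := congrFun h i
  simp only [Basis.map_apply]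
  refine Eq.trans h' ?_
  simp [Pi.single_apply]

/-- Bases of two Lagrangians which share a basis of their intersection. -/
theorem IsLagrangian.exists_adapted_bases (hL : IsLagrangian ω L) (hM : IsLagrangian ω M) :
    ∃ (r s : ℕ) (e : Basis (Fin r ⊕ Fin s) F L) (g : Basis (Fin r ⊕ Fin s) F M),
      r + s = n ∧
      (∀ k, (e (Sum.inr k) : V) = g (Sum.inr k)) ∧
      ∀ v, (∀ k, ω (e (Sum.inr k)) v = 0) → v ∈ ω.orthogonal (L ⊓ M) := by
  have hs : finrank F (L ⊓ M : Submodule F V) ≤ n := by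
    rw [← hL.finrank_eq hnd hn]
    exact Submodule.finrank_mono inf_le_left
  let b := finBasis F (L ⊓ M : Submodule F V)
  obtain ⟨e, he⟩ := exists_basis_sum_extending (inf_le_left : L ⊓ M ≤ L) b
    (ι := Fin (n - finrank F (L ⊓ M : Submodule F V)))
    (by simp [hL.finrank_eq hnd hn, hs])
  obtain ⟨g, hg⟩ := exists_basis_sum_extending (inf_le_right : L ⊓ M ≤ M) b
    (ι := Fin (n - finrank F (L ⊓ M : Submodule F V)))
    (by simp [hM.finrank_eq hnd hn, hs])
  refine ⟨_, _, e, g, by omega, fun k => by rw [he, hg], fun v hv k hk => ?_⟩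
  have h0 : (ω.flip v) ∘ₗ (L ⊓ M).subtype = 0 := b.ext fun i => by simpa [he] using hv i
  simpa using LinearMap.congr_fun h0 ⟨k, hk⟩

end Symplectic

end Lagrangians

/-! ### Orientations in coordinates -/

section Orientations

variable {F V : Type*} [Field F] [AddCommGroup V] [Module F V]

theorem ιMulti_basis_ne_zero {n : ℕ} (b : Basis (Fin n) F V) :
    exteriorPower.ιMulti F n b ≠ 0 := by
  intro h
  have h' := congrArg (exteriorPower.alternatingMapLinearEquiv b.det) h
  rw [exteriorPower.alternatingMapLinearEquiv_apply_ιMulti, Basis.det_self, map_zero] at h'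
  exact one_ne_zero h'

theorem exists_smul_ιMulti_basis {n : ℕ} (b : Basis (Fin n) F V) {o : ⋀[F]^n V} (ho : o ≠ 0) :
    ∃ c : F, c ≠ 0 ∧ o = c • exteriorPower.ιMulti F n b := by
  have : Module.Finite F V := Module.Finite.of_basis b
  have h1 : finrank F (⋀[F]^n V) = 1 := by
    rw [exteriorPower.finrank_eq, finrank_eq_card_basis b, Fintype.card_fin, Nat.choose_self]
  obtain ⟨c, hc⟩ := exists_smul_eq_of_finrank_eq_one h1 (ιMulti_basis_ne_zero b) o
  refine ⟨c, ?_, hc.symm⟩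
  rintro rfl
  exact ho (by rw [← hc, zero_smul])

/-- The coefficient of the orientation of `L` with respect to a basis. -/
def OLag.coeff {ω : LinearMap.BilinForm F V} {n : ℕ} (L : OLag ω n) {ι : Type*}
    (r : Fin n ≃ ι) (b : Basis ι F L.space) : F :=
  (exists_smul_ιMulti_basis (b.reindex r.symm) L.orient_ne_zero).choose

theorem OLag.coeff_ne_zero {ω : LinearMap.BilinForm F V} {n : ℕ} (L : OLag ω n) {ι : Type*}
    (r : Fin n ≃ ι) (b : Basis ι F L.space) : L.coeff r b ≠ 0 :=
  (exists_smul_ιMulti_basis (b.reindex r.symm) L.orient_ne_zero).choose_spec.1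

theorem OLag.orient_eq {ω : LinearMap.BilinForm F V} {n : ℕ} (L : OLag ω n) {ι : Type*}
    (r : Fin n ≃ ι) (b : Basis ι F L.space) :
    L.orient = L.coeff r b • exteriorPower.ιMulti F n (b.reindex r.symm) :=
  (exists_smul_ιMulti_basis (b.reindex r.symm) L.orient_ne_zero).choose_spec.2

/-- The sign in the normalization cancels the one built into `wedgePairing`, leaving a plain
determinant. -/
theorem OLag.wedgePairing_eq {ω : LinearMap.BilinForm F V} {n : ℕ} (L M : OLag ω n) {ι : Type*}
    [Fintype ι] [DecidableEq ι] (r : Fin n ≃ ι) (b : Basis ι F L.space) (c : Basis ι F M.space) :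
    (-1) ^ n.choose 2 * wedgePairing ω n L.space M.space L.orient M.orient =
      L.coeff r b * M.coeff r c * (Matrix.of fun i j => ω (b i) (c j)).det := by
  have hdet : (Matrix.of fun i j : Fin n => ω (b.reindex r.symm i) (c.reindex r.symm j)).det =
      (Matrix.of fun i j => ω (b i) (c j)).det := by
    rw [← Matrix.det_submatrix_equiv_self r]
    congr 1
    ext i j
    simp
  have hsq : ((-1 : F) ^ n.choose 2) * (-1) ^ n.choose 2 = 1 := by
    rw [← mul_pow]; simp
  rw [L.orient_eq r b, M.orient_eq r c]
  simp only [map_smul, LinearMap.smul_apply, wedgePairing_ιMulti, smul_eq_mul, hdet]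
  linear_combination (L.coeff r b * M.coeff r c * (Matrix.of fun i j => ω (b i) (c j)).det) * hsq

/-- Auxiliary Lagrangians may carry any orientation, since it cancels from the composites. -/
theorem exists_orient [FiniteDimensional F V] {ω : LinearMap.BilinForm F V} {n : ℕ}
    {L : Submodule F V} (hL : IsLagrangian ω L) (hd : finrank F L = n) :
    ∃ L' : OLag ω n, L'.space = L :=
  ⟨⟨L, hL, _, ιMulti_basis_ne_zero (finBasisOfFinrankEq F L hd)⟩, rfl⟩

end Orientations

/-! ### Composition of averaging morphisms -/

section Composition

variable {F V : Type*} [Field F] [AddCommGroup V] [Module F V]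
  {ω : LinearMap.BilinForm F V} {n : ℕ} {ψ : AddChar F ℂ}

theorem averaging_apply [Fintype F] [FiniteDimensional F V] (M L : OLag ω n)
    [Fintype M.space] (f : model ψ L) (h : Heisenberg ω) :
    (averaging ψ M L f).1 h = ∑ m : M.space, f.1 (ofVec ω m * h) :=
  finsum_eq_sum_of_fintype _

theorem ofVec_mul_ofVec_mul (hω : ω.IsAlt) (u v : V) (h : Heisenberg ω) (h2 : (2 : F) ≠ 0) :
    ofVec ω u * (ofVec ω v * h) = ofCen ω (ω u v) * (ofVec ω v * (ofVec ω u * h)) := by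
  have hneg : ω v u = - ω u v := (hω.neg_eq v u ▸ by simp : ω v u = - ω u v)
  ext
  · simp [ofVec, ofCen]; abel
  · simp only [ofVec, ofCen, mul_cen, mul_vec, map_add, map_zero, LinearMap.zero_apply, hneg]
    field_simp
    ring

theorem ofVec_add_mul (u v : V) (h : Heisenberg ω) :
    ofVec ω (u + v) * h = ofCen ω (-(2⁻¹ * ω u v)) * (ofVec ω u * (ofVec ω v * h)) := by
  ext
  · simp [ofVec, ofCen]; abel
  · simp only [ofVec, ofCen, mul_cen, mul_vec, map_add, map_zero, LinearMap.zero_apply,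
      LinearMap.add_apply]
    ring

/-- The composition of two averaging morphisms is a multiple of an averaging morphism. -/
theorem averaging_comp [Fintype F] [FiniteDimensional F V] (hω : ω.IsAlt)
    (h2 : (2 : F) ≠ 0) (hψ : ψ ≠ 1)
    (L M N : OLag ω n) [Fintype N.space] (q : N.space → F)
    [DecidablePred fun v : N.space => (v : V) ∈ ω.orthogonal (L.space ⊓ M.space)]
    (hq : ∀ v : N.space, (v : V) ∈ ω.orthogonal (L.space ⊓ M.space) →
      ∃ l ∈ L.space, (v : V) - l ∈ M.space ∧ ω l v = q v) :
    (averaging ψ M N).comp (averaging ψ N L) =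
      (∑ v : N.space, if (v : V) ∈ ω.orthogonal (L.space ⊓ M.space) then ψ (-(2⁻¹ * q v)) else 0) •
        averaging ψ M L := by
  classical
  have : Finite V := Module.finite_of_finite F
  have := Fintype.ofFinite V
  ext f h
  show (averaging ψ M N (averaging ψ N L f)).1 h = _ * (averaging ψ M L f).1 h
  simp only [averaging_apply]
  rw [Finset.sum_comm, Finset.sum_mul]
  refine Finset.sum_congr rfl fun v _ => ?_
  split_ifs with hv
  · obtain ⟨l, hl, hm, hlq⟩ := hq v hv
    rw [← Equiv.sum_comp (Equiv.addLeft (⟨v - l, hm⟩ : M.space))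
      (fun m : M.space => f.1 (ofVec ω m * h)), Finset.mul_sum]
    refine Finset.sum_congr rfl fun m _ => ?_
    have hvl : ofVec ω (v : V) = ofVec ω (l + (v - l)) := by rw [add_sub_cancel]
    have hlv : ω l (v - l) = q v := by
      rw [map_sub, L.isLagrangian.apply_eq_zero hl hl, sub_zero, hlq]
    rw [hvl, ofVec_add_mul, f.2.1, f.2.2 l hl, hlv, ← mul_assoc (ofVec ω _),
      M.isLagrangian.ofVec_mul hm m.2]
    rfl
  · rw [zero_mul]
    -- Translating the sum over `M` by a multiple of `k` leaves it unchanged, but moving that vector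
    -- past `v` into `L` produces a factor `ψ z ≠ 1`. Hence the sum vanishes.
    obtain ⟨k, hk, hkv⟩ : ∃ k ∈ L.space ⊓ M.space, ω k v ≠ 0 := by
      by_contra! hcon
      exact hv hcon
    have hvk : ω v k ≠ 0 := by
      rw [← hω.neg_eq]; exact neg_ne_zero.2 hkv
    obtain ⟨z, hz⟩ : ∃ z, ψ z ≠ 1 := by
      by_contra! hcon
      exact hψ (DFunLike.ext _ _ hcon)
    let k' : V := (z * (ω v k)⁻¹) • k
    have hk' : k' ∈ L.space ⊓ M.space := Submodule.smul_mem _ _ hk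
    have hvk' : ω v k' = z := by
      simp only [k', map_smul, smul_eq_mul]
      field_simp
    have hsum : ∑ m : M.space, f.1 (ofVec ω v * (ofVec ω m * h)) =
        ψ z * ∑ m : M.space, f.1 (ofVec ω v * (ofVec ω m * h)) := by
      conv_lhs => rw [← Equiv.sum_comp (Equiv.addLeft (⟨k', hk'.2⟩ : M.space))]
      rw [Finset.mul_sum]
      refine Finset.sum_congr rfl fun m _ => ?_
      have : ofVec ω ((Equiv.addLeft (⟨k', hk'.2⟩ : M.space) m : M.space) : V) =
          ofVec ω k' * ofVec ω m := (M.isLagrangian.ofVec_mul hk'.2 m.2).symm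
      rw [this, mul_assoc, ofVec_mul_ofVec_mul hω _ _ _ h2, f.2.1, f.2.2 k' hk'.1, hvk']
    have hfac : (ψ z - 1) * ∑ m : M.space, f.1 (ofVec ω v * (ofVec ω m * h)) = 0 := by
      linear_combination -hsum
    exact (mul_eq_zero.1 hfac).resolve_left (sub_ne_zero.2 hz)

end Composition

/-! ### The scalar of a composite -/

section Normalization

variable {F V : Type*} [Field F] [AddCommGroup V] [Module F V]
  [FiniteDimensional F V] {ω : LinearMap.BilinForm F V} {n : ℕ} {ψ : AddChar F ℂ}

/-- In terms of adapted bases of `L` and `M`, a Lagrangian `N` transversal to both is described by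
a symmetric matrix `a`. -/
theorem exists_symm_matrix (hω : ω.IsAlt) (hnd : ω.Nondegenerate) (hn : finrank F V = 2 * n)
    {L M N : Submodule F V} (hL : IsLagrangian ω L) (hM : IsLagrangian ω M)
    (hN : IsLagrangian ω N) (hLN : L ⊓ N = ⊥) (hNM : N ⊓ M = ⊥)
    {ι κ : Type*} [Fintype ι] [Fintype κ] [DecidableEq ι] [DecidableEq κ]
    (e : Basis (ι ⊕ κ) F L) (g : Basis (ι ⊕ κ) F M)
    (heg : ∀ k, (e (Sum.inr k) : V) = g (Sum.inr k))
    (hK : ∀ v, (∀ k, ω (e (Sum.inr k)) v = 0) → v ∈ ω.orthogonal (L ⊓ M)) :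
    ∃ (f : Basis (ι ⊕ κ) F N) (a : Matrix ι ι F), a.IsSymm ∧ a.det ≠ 0 ∧
      (∀ i j, ω (e i) (f j) = if i = j then 1 else 0) ∧
      (Matrix.of fun i j => ω (f i) (g j)).det = (-1) ^ Fintype.card κ *
        (a.det * (Matrix.of fun i j => ω (e (Sum.inl i)) (g (Sum.inl j))).det) ∧
      (∀ v : N, (v : V) ∈ ω.orthogonal (L ⊓ M) ↔ ∀ k, f.equivFun v (Sum.inr k) = 0) ∧
      ∀ v : N, (v : V) ∈ ω.orthogonal (L ⊓ M) → ∃ l ∈ L, (v : V) - l ∈ M ∧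
        ω l v = (fun i => f.equivFun v (Sum.inl i)) ⬝ᵥ
          a *ᵥ (fun i => f.equivFun v (Sum.inl i)) := by
  obtain ⟨f, hf⟩ := hL.exists_dual_basis hnd hn hN hLN e
  have hcoord : ∀ (v : N) i, ω (e i) v = f.equivFun v i := by
    intro v i
    conv_lhs => rw [← f.sum_equivFun v]
    simp [hf, -Fintype.sum_sum_type, -Basis.sum_repr, -Basis.equivFun_apply]
  have hmem : ∀ v : N, (v : V) ∈ ω.orthogonal (L ⊓ M) ↔
      ∀ k, f.equivFun v (Sum.inr k) = 0 := by
    intro v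
    refine ⟨fun h k => ?_, fun h => hK v fun k => ?_⟩
    · rw [← hcoord]
      refine h _ ⟨(e (Sum.inr k)).2, ?_⟩
      rw [heg]
      exact (g (Sum.inr k)).2
    · rw [hcoord, h]
  have hdec : ∀ i : ι, ∃ l ∈ L, (f (Sum.inl i) : V) - l ∈ M := by
    intro i
    have h : (f (Sum.inl i) : V) ∈ ω.orthogonal (L ⊓ M) := by
      rw [hmem]
      intro k
      simp
    rw [IsLagrangian.orthogonal_inf hω hnd hL hM] at h
    obtain ⟨l, hl, m, hm, hlm⟩ := Submodule.mem_sup.1 h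
    exact ⟨l, hl, by rwa [← hlm, add_sub_cancel_left]⟩
  choose l hl hlm using hdec
  -- Writing `f i = l i + m i` with `m i ∈ M`, symmetry of `a` expresses that `L`, `M` and `N` are
  -- all isotropic.
  let a : Matrix ι ι F := Matrix.of fun i j => ω (l i) (f (Sum.inl j))
  have hanti : ∀ u v, ω u v = - ω v u := fun u v => (hω.neg_eq v u).symm
  have ha : a.IsSymm := by
    ext i j
    have h1 := hN.apply_eq_zero (f (Sum.inl i)).2 (f (Sum.inl j)).2
    have h2 := hM.apply_eq_zero (hlm i) (hlm j)
    have h3 := hL.apply_eq_zero (hl i) (hl j)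
    simp only [map_sub, LinearMap.sub_apply, h1, h3] at h2
    have h4 := hanti (f (Sum.inl i)) (l j)
    simp only [a, Matrix.transpose_apply, Matrix.of_apply]
    linear_combination h2 + h4
  have hlg : ∀ i j, ω (l i) (g (Sum.inl j)) =
      ∑ i', a i i' * ω (e (Sum.inl i')) (g (Sum.inl j)) := by
    intro i j
    have hrepr : ∀ k, e.equivFun ⟨l i, hl i⟩ k = ω (l i) (f k) := by
      intro k
      have h : ω ((⟨l i, hl i⟩ : L) : V) (f k) = e.equivFun ⟨l i, hl i⟩ k := by
        conv_lhs => rw [← e.sum_equivFun ⟨l i, hl i⟩]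
        simp [hf, -Fintype.sum_sum_type, -Basis.sum_repr, -Basis.equivFun_apply]
      exact h.symm
    have h : ω ((⟨l i, hl i⟩ : L) : V) (g (Sum.inl j)) =
        ∑ k, ω (l i) (f k) * ω (e k) (g (Sum.inl j)) := by
      conv_lhs => rw [← e.sum_equivFun ⟨l i, hl i⟩]
      simp only [hrepr]
      simp
    rw [Fintype.sum_sum_type] at h
    refine h.trans ?_
    simp only [heg, hM.apply_eq_zero (g _).2 (g _).2]
    simp [a]
  have hdet : (Matrix.of fun i j => ω (f i) (g j)).det = (-1) ^ Fintype.card κ *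
      (a.det * (Matrix.of fun i j => ω (e (Sum.inl i)) (g (Sum.inl j))).det) := by
    -- The shared vectors make the last block column known by duality: `0` above and `-1` below. In
    -- the upper left block `f i` may be replaced by `l i`, whose coordinates in `e` along `ι` are
    -- row `i` of `a`.
    have hblock : (Matrix.of fun i j => ω (f i) (g j)) =
        Matrix.fromBlocks (a * Matrix.of fun i j => ω (e (Sum.inl i)) (g (Sum.inl j))) 0
          (Matrix.of fun k j => ω (f (Sum.inr k)) (g (Sum.inl j))) (-1) := by
      ext i j
      rcases i with i | i <;> rcases j with j | j
      · have h := hM.apply_eq_zero (hlm i) (g (Sum.inl j)).2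
        rw [map_sub, LinearMap.sub_apply, sub_eq_zero] at h
        simp [Matrix.mul_apply, h, hlg]
      · simp only [Matrix.of_apply, Matrix.fromBlocks_apply₁₂, Matrix.zero_apply]
        rw [← heg, hanti, hf]
        simp
      · simp
      · simp only [Matrix.of_apply, Matrix.fromBlocks_apply₂₂, Matrix.neg_apply]
        rw [← heg, hanti, hf, Matrix.one_apply]
        simp [eq_comm]
    rw [hblock, Matrix.det_fromBlocks_zero₁₂, Matrix.det_mul, Matrix.det_neg, Matrix.det_one,
      mul_one, mul_comm]
  refine ⟨f, a, ha, ?_, hf, hdet, hmem, fun v hv => ?_⟩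
  · intro h0
    refine hN.det_ne_zero hNM f g ?_
    rw [hdet, h0, zero_mul, mul_zero]
  · have hv0 := (hmem v).1 hv
    have hvsum : (v : V) = ∑ i, f.equivFun v (Sum.inl i) • (f (Sum.inl i) : V) := by
      conv_lhs => rw [← f.sum_equivFun v, Fintype.sum_sum_type]
      simp [hv0, -Basis.equivFun_apply]
    refine ⟨∑ i, f.equivFun v (Sum.inl i) • l i,
      Submodule.sum_mem _ fun i _ => Submodule.smul_mem _ _ (hl i), ?_, ?_⟩
    · nth_rewrite 1 [hvsum]
      rw [← Finset.sum_sub_distrib]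
      refine Submodule.sum_mem _ fun i _ => ?_
      rw [← smul_sub]
      exact Submodule.smul_mem _ _ (hlm i)
    · refine (congrArg (ω _) hvsum).trans ?_
      simp only [map_sum, LinearMap.sum_apply, map_smul, LinearMap.smul_apply, smul_eq_mul,
        dotProduct, Matrix.mulVec, Finset.mul_sum]
      rw [Finset.sum_comm]
      refine Finset.sum_congr rfl fun i _ => Finset.sum_congr rfl fun j _ => ?_
      simp only [a, Matrix.of_apply]
      ring

variable [Fintype F] [DecidableEq F]

theorem ansatz_comp (hF : ringChar F ≠ 2) (hω : ω.IsAlt) (hnd : ω.Nondegenerate)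
    (hn : finrank F V = 2 * n) (hψ : ψ ≠ 1) (L M N : OLag ω n)
    (hNL : N.space ⊔ L.space = ⊤) (hMN : M.space ⊔ N.space = ⊤)
    {ι κ : Type*} [Fintype ι] [Fintype κ] [DecidableEq ι] [DecidableEq κ]
    (e : Basis (ι ⊕ κ) F L.space) (g : Basis (ι ⊕ κ) F M.space) (r : Fin n ≃ ι ⊕ κ)
    (heg : ∀ k, (e (Sum.inr k) : V) = g (Sum.inr k))
    (hK : ∀ v, (∀ k, ω (e (Sum.inr k)) v = 0) → v ∈ ω.orthogonal (L.space ⊓ M.space)) :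
    (ansatz ψ M N).comp (ansatz ψ N L) =
      (((Fintype.card F : ℂ)⁻¹) ^ n * gaussSum₁ ψ ^ Fintype.card ι *
        (quadraticChar F (L.coeff r e * M.coeff r g *
          (Matrix.of fun i j => ω (e (Sum.inl i)) (g (Sum.inl j))).det) : ℤ)) •
        averaging ψ M L := by
  classical
  have h2 : (2 : F) ≠ 0 := Ring.two_ne_zero hF
  have : Finite V := Module.finite_of_finite F
  have := Fintype.ofFinite V
  rw [sup_comm, L.isLagrangian.sup_eq_top_iff hnd hn N.isLagrangian] at hNL
  rw [sup_comm, N.isLagrangian.sup_eq_top_iff hnd hn M.isLagrangian] at hMN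
  obtain ⟨f, a, hsymm, hdet, hef, hfg, hmem, hq⟩ := exists_symm_matrix hω hnd hn L.isLagrangian
    M.isLagrangian N.isLagrangian hNL hMN e g heg hK
  have hsum : (∑ v : N.space, if (v : V) ∈ ω.orthogonal (L.space ⊓ M.space) then
      ψ (-(2⁻¹ * ((fun i => f.equivFun v (Sum.inl i)) ⬝ᵥ
          a *ᵥ (fun i => f.equivFun v (Sum.inl i))))) else 0) =
      (quadraticChar F ((-1) ^ Fintype.card ι * a.det) : ℤ) *
        gaussSum₁ ψ ^ Fintype.card ι := by
    rw [← Matrix.det_neg, ← sum_quadratic_form hF hψ (-a)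
      (by rw [Matrix.IsSymm, Matrix.transpose_neg, hsymm])
      (by rw [Matrix.det_neg]; exact mul_ne_zero (pow_ne_zero _ (by simp)) hdet)]
    -- Split the coordinates of `v` along `ι` and `κ`; membership in `(L ∩ M)^⊥` forces the `κ` part
    -- to vanish.
    rw [← Equiv.sum_comp ((Equiv.sumArrowEquivProdArrow ι κ F).symm.trans
      f.equivFun.symm.toEquiv), Fintype.sum_prod_type]
    refine Finset.sum_congr rfl fun x _ => ?_
    simp only [hmem]
    rw [Finset.sum_eq_single 0]
    · simp [Equiv.sumArrowEquivProdArrow, -Basis.equivFun_symm_apply, -Basis.equivFun_apply,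
        Matrix.neg_mulVec]
    · intro y _ hy
      rw [if_neg]
      intro h
      refine hy (funext fun k => ?_)
      simpa [Equiv.sumArrowEquivProdArrow, -Basis.equivFun_symm_apply, -Basis.equivFun_apply]
        using h k
    · simp
  have hcomp := averaging_comp (ψ := ψ) hω h2 hψ L M N _ hq
  rw [hsum] at hcomp
  have hMNn : normalization ψ M N = (gaussSum₁ ψ / Fintype.card F) ^ n *
      (quadraticChar F (N.coeff r f * M.coeff r g * ((-1) ^ Fintype.card κ *
        (a.det * (Matrix.of fun i j => ω (e (Sum.inl i)) (g (Sum.inl j))).det))) : ℤ) := by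
    rw [normalization, N.wedgePairing_eq M r f g, hfg]
  have hone : (Matrix.of fun i j => ω (e i) (f j)) = 1 := by
    ext i j
    simp [hef, Matrix.one_apply]
  have hNLn : normalization ψ N L = (gaussSum₁ ψ / Fintype.card F) ^ n *
      (quadraticChar F (L.coeff r e * N.coeff r f) : ℤ) := by
    rw [normalization, L.wedgePairing_eq N r e f, hone, Matrix.det_one, mul_one]
  have hcard : n = Fintype.card ι + Fintype.card κ := by
    have := Fintype.card_congr r
    simpa using this
  have hexp : (ansatz ψ M N).comp (ansatz ψ N L) =
      (normalization ψ M N * normalization ψ N L) •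
        (averaging ψ M N).comp (averaging ψ N L) := by
    ext v h
    show normalization ψ M N * (averaging ψ M N (normalization ψ N L • averaging ψ N L v)).1 h =
      (normalization ψ M N * normalization ψ N L) * (averaging ψ M N (averaging ψ N L v)).1 h
    rw [map_smul, mul_assoc]
    rfl
  rw [hexp, hcomp, smul_smul, hMNn, hNLn]
  congr 1
  have hσ : ∀ {x : F}, x ≠ 0 →
      ((quadraticChar F x : ℤ) : ℂ) * ((quadraticChar F x : ℤ) : ℂ) = 1 := by
    intro x hx
    have := quadraticChar_sq_one hx
    rw [sq] at this
    exact_mod_cast this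
  have hG := gaussSum₁_sq hF hψ
  have hq0 : (Fintype.card F : ℂ) ≠ 0 := by simp
  have hG' : (gaussSum₁ ψ / Fintype.card F) ^ n * (gaussSum₁ ψ / Fintype.card F) ^ n =
      ((quadraticChar F (-1) : ℤ) : ℂ) ^ n * ((Fintype.card F : ℂ)⁻¹) ^ n := by
    rw [← mul_pow, ← mul_pow, ← sq, div_pow, hG]
    congr 1
    field_simp
  have h1 := hσ (neg_ne_zero.2 (one_ne_zero (α := F)))
  -- The three sources of `σ(-1)` are `G₁ ^ (2 * n)`, the block `-1`, and the sign of the form `-a`;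
  -- their exponents add up to `2 * n`.
  have h1n : ((quadraticChar F (-1) : ℤ) : ℂ) ^ n * (((quadraticChar F (-1) : ℤ) : ℂ) ^
      Fintype.card κ * ((quadraticChar F (-1) : ℤ) : ℂ) ^ Fintype.card ι) = 1 := by
    rw [← pow_add, add_comm (Fintype.card κ), ← hcard, ← mul_pow, h1, one_pow]
  have hN := hσ (N.coeff_ne_zero r f)
  have ha := hσ hdet
  simp only [map_mul, map_pow]
  push_cast
  generalize ((quadraticChar F (N.coeff r f) : ℤ) : ℂ) = sN at *
  generalize ((quadraticChar F a.det : ℤ) : ℂ) = sa at *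
  generalize ((quadraticChar F (-1) : ℤ) : ℂ) = s1 at *
  generalize ((quadraticChar F (L.coeff r e) : ℤ) : ℂ) = sL at *
  generalize ((quadraticChar F (M.coeff r g) : ℤ) : ℂ) = sM at *
  generalize ((quadraticChar F
    (Matrix.of fun i j => ω (e (Sum.inl i)) (g (Sum.inl j))).det : ℤ) : ℂ) = sW at *
  generalize (gaussSum₁ ψ / Fintype.card F) ^ n = A at *
  generalize gaussSum₁ ψ ^ Fintype.card ι = B at *
  generalize s1 ^ Fintype.card κ = u at *
  generalize s1 ^ Fintype.card ι = w at *
  generalize ((Fintype.card F : ℂ)⁻¹) ^ n = Q at *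
  generalize s1 ^ n = t at *
  calc _ = (A * A) * (u * w) * (sN * sN) * (sa * sa) * (sL * sM * sW) * B := by ring
    _ = Q * (t * (u * w)) * (sN * sN) * (sa * sa) * (sL * sM * sW) * B := by rw [hG']; ring
    _ = _ := by rw [h1n, hN, ha]; ring

end Normalization

/-! ### Existence of common transversals -/

section Transversals

variable {F V : Type*} [Field F] [AddCommGroup V] [Module F V]

variable {ω : LinearMap.BilinForm F V} {L M N P : Submodule F V}

theorem eq_zero_of_orthogonal_sup (hnd : ω.Nondegenerate) (h : L ⊔ M = ⊤) {v : V}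
    (hL : ∀ l ∈ L, ω l v = 0) (hM : ∀ m ∈ M, ω m v = 0) : v = 0 := by
  refine hnd.2 v fun w => ?_
  have hw : w ∈ L ⊔ M := h ▸ Submodule.mem_top
  obtain ⟨l, hl, m, hm, rfl⟩ := Submodule.mem_sup.1 hw
  rw [map_add, LinearMap.add_apply, hL l hl, hM m hm, add_zero]

/-- If `l + m` is orthogonal to `M`, then `l` is orthogonal to both `L` and `M`, hence zero. -/
theorem isLagrangian_of_isotropic (hnd : ω.Nondegenerate) (hL : IsLagrangian ω L)
    (hM : ∀ x ∈ M, ∀ y ∈ M, ω x y = 0) (h : L ⊔ M = ⊤) : IsLagrangian ω M := by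
  refine le_antisymm (fun v hv => ?_) fun v hv w hw => hM w hw v hv
  have hv' : v ∈ L ⊔ M := h ▸ Submodule.mem_top
  obtain ⟨l, hl, m, hm, rfl⟩ := Submodule.mem_sup.1 hv'
  have hl0 : l = 0 := by
    refine eq_zero_of_orthogonal_sup hnd h (fun l' hl' => hL.apply_eq_zero hl' hl)
      fun m' hm' => ?_
    have h1 : ω m' (l + m) = 0 := hv m' hm'
    rwa [map_add, hM m' hm' m hm, add_zero] at h1
  rwa [hl0, zero_add]

theorem graph_sup {C : Submodule F V} (h : L ⊔ C = ⊤) (φ : C →ₗ[F] L) :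
    L ⊔ LinearMap.range (C.subtype + L.subtype ∘ₗ φ) = ⊤ := by
  refine eq_top_iff.2 (h ▸ sup_le le_sup_left fun c hc => ?_)
  have h1 : c = -(φ ⟨c, hc⟩ : V) + (C.subtype + L.subtype ∘ₗ φ) ⟨c, hc⟩ := by simp
  rw [h1]
  exact add_mem (Submodule.mem_sup_left (neg_mem (φ _).2))
    (Submodule.mem_sup_right (LinearMap.mem_range_self _ _))

variable [FiniteDimensional F V]

/-- Over a field with at least three elements there is a nondegenerate symmetric form whose
difference with a given symmetric form is nondegenerate. -/
theorem exists_symm_form (h2 : (2 : F) ≠ 0) (A : LinearMap.BilinForm F V)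
    (hA : ∀ x y, A x y = A y x) :
    ∃ S : LinearMap.BilinForm F V, (∀ x y, S x y = S y x) ∧ (∀ x, (∀ y, S x y = 0) → x = 0) ∧
      ∀ x, (∀ y, S x y = A x y) → x = 0 := by
  classical
  have := invertibleOfNonzero h2
  obtain ⟨v, hv⟩ := LinearMap.BilinForm.exists_orthogonal_basis
    (show LinearMap.IsSymm A from ⟨hA⟩)
  -- The form sought is diagonal in a basis orthogonal for `A`. One of `1`, `-1` always serves, as
  -- they differ by `2 ≠ 0`.
  have hs : ∀ i, ∃ s : F, s ≠ 0 ∧ s ≠ A (v i) (v i) := by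
    intro i
    by_cases h : A (v i) (v i) = 1
    · refine ⟨-1, by simp, ?_⟩
      rw [h]
      intro h1
      exact h2 (by linear_combination -h1)
    · exact ⟨1, one_ne_zero, Ne.symm h⟩
  choose s hs0 hsA using hs
  let S : LinearMap.BilinForm F V :=
    ∑ i, s i • LinearMap.BilinForm.linMulLin (v.coord i) (v.coord i)
  have hS : ∀ x y, S x y = ∑ i, s i * (v.repr x i * v.repr y i) := by
    intro x y
    simp [S]
  have hSv : ∀ x j, S x (v j) = s j * v.repr x j := by
    intro x j
    rw [hS, Finset.sum_eq_single j]
    · simp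
    · intro i _ hij
      simp [hij.symm]
    · simp
  have hAv : ∀ x j, A x (v j) = A (v j) (v j) * v.repr x j := by
    intro x j
    conv_lhs => rw [← v.sum_repr x]
    simp only [map_sum, map_smul, LinearMap.sum_apply, LinearMap.smul_apply, smul_eq_mul]
    rw [Finset.sum_eq_single j]
    · ring
    · intro i _ hij
      rw [hv hij, mul_zero]
    · simp
  refine ⟨S, fun x y => ?_, fun x hx => ?_, fun x hx => ?_⟩
  · simp only [hS, mul_comm]
  · refine v.ext_elem fun j => ?_
    have h := hx (v j)
    rw [hSv] at h
    simpa [hs0 j] using h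
  · refine v.ext_elem fun j => ?_
    have h := hx (v j)
    rw [hSv, hAv, ← sub_eq_zero, ← sub_mul] at h
    simpa [sub_ne_zero.2 (hsA j)] using h

/-- The form `ω` identifies `L` with the dual of any complement. -/
theorem IsLagrangian.exists_linearMap {n : ℕ} (hω : ω.IsAlt) (hnd : ω.Nondegenerate)
    (hn : finrank F V = 2 * n) (hL : IsLagrangian ω L) {C : Submodule F V} (hC : IsCompl L C)
    (B : LinearMap.BilinForm F C) : ∃ φ : C →ₗ[F] L, ∀ c c' : C, ω (φ c) c' = B c c' := by
  let Ψ : L →ₗ[F] Dual F C := ω.domRestrict₁₂ L C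
  have hinj : Function.Injective Ψ := by
    rw [← LinearMap.ker_eq_bot, LinearMap.ker_eq_bot']
    intro l hl
    refine Subtype.ext (eq_zero_of_orthogonal_sup hnd hC.sup_eq_top
      (fun l' hl' => hL.apply_eq_zero hl' l.2) fun c hc => ?_)
    rw [← hω.neg_eq]
    exact neg_eq_zero.2 (LinearMap.congr_fun hl ⟨c, hc⟩)
  have hdim : finrank F L = finrank F (Dual F C) := by
    have h := Submodule.finrank_add_eq_of_isCompl hC
    have h' := hL.finrank_eq hnd hn
    rw [Subspace.dual_finrank_eq]
    omega
  let E : L ≃ₗ[F] Dual F C := LinearEquiv.ofInjectiveOfFinrankEq Ψ hinj hdim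
  refine ⟨E.symm.toLinearMap ∘ₗ B, fun c c' => ?_⟩
  exact LinearMap.congr_fun (E.apply_symm_apply (B c)) c'

theorem IsLagrangian.exists_transversal {n : ℕ} (h2 : (2 : F) ≠ 0) (hω : ω.IsAlt)
    (hnd : ω.Nondegenerate) (hn : finrank F V = 2 * n) (hL : IsLagrangian ω L) :
    ∃ N, IsLagrangian ω N ∧ L ⊔ N = ⊤ := by
  obtain ⟨C, hC⟩ := Submodule.exists_isCompl L
  -- On the graph of `φ` each of the two cross terms contributes `-ω(c, c') / 2`, which makes the
  -- graph isotropic.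
  obtain ⟨φ, hφ⟩ := hL.exists_linearMap hω hnd hn hC (-(2⁻¹ : F) • ω.restrict C)
  refine ⟨_, isLagrangian_of_isotropic hnd hL ?_ (graph_sup hC.sup_eq_top φ),
    graph_sup hC.sup_eq_top φ⟩
  rintro _ ⟨c, rfl⟩ _ ⟨c', rfl⟩
  have h1 := hφ c c'
  have h3 := hφ c' c
  have h4 := hL.apply_eq_zero (φ c).2 (φ c').2
  have h5 := (hω.neg_eq (φ c' : V) c).symm
  have h6 := (hω.neg_eq (c' : V) c).symm
  simp only [LinearMap.smul_apply, LinearMap.BilinForm.restrict_apply, LinearMap.domRestrict_apply,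
    smul_eq_mul] at h1 h3
  simp only [LinearMap.add_apply, LinearMap.comp_apply, Submodule.subtype_apply, map_add, h1, h4]
  rw [h3] at h5
  have h7 : ω (c : V) (φ c' : V) = 2⁻¹ * ω (c' : V) c := by linear_combination h5
  rw [h7, h6]
  field_simp
  ring

/-- The graph of `φ : N → M` attached to a symmetric form `S` is a Lagrangian transversal to `M`. It
is transversal to `N` when `S` is nondegenerate. It is transversal to `P` when, on the projection
`U` of `P` to `N`, `S` minus the form `A` determined by `P` is nondegenerate. -/
theorem IsLagrangian.exists_common_transversal {n : ℕ} (h2 : (2 : F) ≠ 0) (hω : ω.IsAlt)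
    (hnd : ω.Nondegenerate) (hn : finrank F V = 2 * n) (hM : IsLagrangian ω M)
    (hN : IsLagrangian ω N) (hP : IsLagrangian ω P) (hMN : M ⊔ N = ⊤) :
    ∃ R, IsLagrangian ω R ∧ M ⊔ R = ⊤ ∧ N ⊔ R = ⊤ ∧ P ⊔ R = ⊤ := by
  have hanti : ∀ u v, ω u v = - ω v u := fun u v => (hω.neg_eq v u).symm
  have hMN0 : M ⊓ N = ⊥ := (hM.sup_eq_top_iff hnd hn hN).1 hMN
  have hc : IsCompl M N := IsCompl.of_eq hMN0 hMN
  let E := Submodule.prodEquivOfIsCompl M N hc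
  let pM : V →ₗ[F] M := LinearMap.fst F M N ∘ₗ E.symm.toLinearMap
  let pN : V →ₗ[F] N := LinearMap.snd F M N ∘ₗ E.symm.toLinearMap
  have hdec : ∀ v : V, (pM v : V) + pN v = v := fun v => E.apply_symm_apply v
  have hpN : ∀ (m : M) (v : N), pN ((v : V) + m) = v := by
    intro m v
    have h : E (m, v) = (v : V) + m := by
      simp [E, add_comm]
    show (E.symm ((v : V) + m)).2 = v
    rw [← h, E.symm_apply_apply]
  let π : P →ₗ[F] N := pN ∘ₗ P.subtype
  let U := LinearMap.range π
  obtain ⟨s, hs⟩ := π.rangeRestrict.exists_rightInverse_of_surjective π.range_rangeRestrict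
  have hs' : ∀ u : U, pN (s u) = u := fun u => congrArg Subtype.val (LinearMap.congr_fun hs u)
  let A : LinearMap.BilinForm F U :=
    ω.compl₁₂ (M.subtype ∘ₗ pM ∘ₗ P.subtype ∘ₗ s) (N.subtype ∘ₗ U.subtype)
  have hAω : ∀ u u' : U, A u u' = ω (pM (s u)) (u' : N) := fun _ _ => rfl
  have hdec' : ∀ u : U, (s u : V) = pM (s u) + (u : N) := fun u => by
    rw [← hs' u]
    exact (hdec _).symm
  have hA : ∀ u u', A u u' = A u' u := by
    intro u u'
    have h := hP.apply_eq_zero (s u).2 (s u').2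
    rw [hdec' u, hdec' u'] at h
    simp only [map_add, LinearMap.add_apply, hM.apply_eq_zero (pM _).2 (pM _).2,
      hN.apply_eq_zero (u : N).2 (u' : N).2] at h
    rw [hAω, hAω]
    linear_combination h - hanti (u : N) (pM (s u'))
  obtain ⟨SU, hSU, hSU0, hSUA⟩ := exists_symm_form h2 A hA
  obtain ⟨W, hUW⟩ := Submodule.exists_isCompl U
  -- `P` imposes no condition on the complement `W`; only nondegeneracy is needed there.
  obtain ⟨SW, hSW, hSW0, -⟩ := exists_symm_form h2 (0 : LinearMap.BilinForm F W) (by simp)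
  let E' := Submodule.prodEquivOfIsCompl U W hUW
  let p : N →ₗ[F] U := LinearMap.fst F U W ∘ₗ E'.symm.toLinearMap
  let q : N →ₗ[F] W := LinearMap.snd F U W ∘ₗ E'.symm.toLinearMap
  have hpq : ∀ v : N, (p v : N) + q v = v := fun v => E'.apply_symm_apply v
  have hEu : ∀ u : U, E'.symm u = (u, 0) := fun u => by
    rw [LinearEquiv.symm_apply_eq]; simp [E']
  have hEw : ∀ w : W, E'.symm w = (0, w) := fun w => by
    rw [LinearEquiv.symm_apply_eq]; simp [E']
  have hpu : ∀ u : U, p u = u := fun u => congrArg Prod.fst (hEu u)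
  have hqu : ∀ u : U, q u = 0 := fun u => congrArg Prod.snd (hEu u)
  have hpw : ∀ w : W, p w = 0 := fun w => congrArg Prod.fst (hEw w)
  have hqw : ∀ w : W, q w = w := fun w => congrArg Prod.snd (hEw w)
  let S : LinearMap.BilinForm F N := SU.compl₁₂ p p + SW.compl₁₂ q q
  have hS : ∀ x y, S x y = SU (p x) (p y) + SW (q x) (q y) := fun _ _ => rfl
  have hS0 : ∀ x, (∀ y, S x y = 0) → x = 0 := by
    intro x hx
    rw [← hpq x, hSU0 (p x) fun u => ?_, hSW0 (q x) fun w => ?_]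
    · simp
    · simpa [hS, hpw, hqw] using hx w
    · simpa [hS, hpu, hqu] using hx u
  obtain ⟨φ, hφ⟩ := hM.exists_linearMap hω hnd hn hc S
  have hsup := graph_sup hMN φ
  have hR := isLagrangian_of_isotropic (M := LinearMap.range (N.subtype + M.subtype ∘ₗ φ))
    hnd hM (by
      rintro _ ⟨c, rfl⟩ _ ⟨c', rfl⟩
      simp only [LinearMap.add_apply, LinearMap.comp_apply, Submodule.subtype_apply, map_add,
        hM.apply_eq_zero (φ c).2 (φ c').2, hN.apply_eq_zero c.2 c'.2]
      rw [hanti c (φ c'), hφ, hφ, hS, hS, hSU, hSW]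
      ring) hsup
  refine ⟨_, hR, hsup, (hN.sup_eq_top_iff hnd hn hR).2 ?_, (hP.sup_eq_top_iff hnd hn hR).2 ?_⟩
  · rw [Submodule.eq_bot_iff]
    rintro _ ⟨hx, c, rfl⟩
    have hφc : (φ c : V) ∈ M ⊓ N := by
      refine ⟨(φ c).2, ?_⟩
      have h := sub_mem hx c.2
      simpa using h
    rw [hMN0, Submodule.mem_bot] at hφc
    have hc0 : c = 0 := hS0 c fun c' => by rw [← hφ, hφc]; simp
    simp [hc0]
  · rw [Submodule.eq_bot_iff]
    rintro _ ⟨hx, c, rfl⟩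
    simp only [LinearMap.add_apply, LinearMap.comp_apply, Submodule.subtype_apply] at hx ⊢
    have hπ : π ⟨_, hx⟩ = c := hpN (φ c) c
    let u : U := ⟨c, ⟨_, hπ⟩⟩
    have hu : u = 0 := by
      -- Both `c + φ c` and `s u` lie in `P` and have the same component `c` in `N`. Pairing each
      -- with `s u'` and subtracting gives `S = A` at `(u, u')`.
      refine hSUA u fun u' => ?_
      have h1 : SU u u' = ω (φ c) (u' : N) := by
        have hSu : S (u : N) (u' : N) = SU u u' := by simp [hS, hpu, hqu]
        rw [hφ, ← hSu]
      have h3 := hP.apply_eq_zero hx (s u').2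
      have h4 := hP.apply_eq_zero (s u).2 (s u').2
      rw [hdec' u'] at h3 h4
      rw [hdec' u] at h4
      have hcu : ((u : N) : V) = c := rfl
      simp only [hcu, map_add, LinearMap.add_apply, hM.apply_eq_zero (φ c).2 (pM _).2,
        hM.apply_eq_zero (pM _).2 (pM _).2] at h3 h4
      rw [h1, hAω]
      linear_combination h3 - h4
    have hc0 : c = 0 := congrArg Subtype.val hu
    simp [hc0]

end Transversals

/-! ### Construction of the trivialization -/

section Trivialization

variable {F V : Type*} [Field F] [AddCommGroup V] [Module F V] [FiniteDimensional F V]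
  {ω : LinearMap.BilinForm F V} {n : ℕ} {ψ : AddChar F ℂ}

theorem OLag.exists_common_transversal (h2 : (2 : F) ≠ 0) (hω : ω.IsAlt) (hnd : ω.Nondegenerate)
    (hn : finrank F V = 2 * n) (M N P : OLag ω n) (hMN : M.space ⊔ N.space = ⊤) :
    ∃ R : OLag ω n, M.space ⊔ R.space = ⊤ ∧ N.space ⊔ R.space = ⊤ ∧ P.space ⊔ R.space = ⊤ := by
  obtain ⟨R, hR, h⟩ := M.isLagrangian.exists_common_transversal h2 hω hnd hn N.isLagrangian
    P.isLagrangian hMN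
  obtain ⟨R', rfl⟩ := exists_orient hR (hR.finrank_eq hnd hn)
  exact ⟨R', h⟩

theorem OLag.exists_transversal (h2 : (2 : F) ≠ 0) (hω : ω.IsAlt) (hnd : ω.Nondegenerate)
    (hn : finrank F V = 2 * n) (M L : OLag ω n) :
    ∃ N : OLag ω n, M.space ⊔ N.space = ⊤ ∧ N.space ⊔ L.space = ⊤ := by
  obtain ⟨R, hR, h⟩ := M.isLagrangian.exists_transversal h2 hω hnd hn
  obtain ⟨R', rfl⟩ := exists_orient hR (hR.finrank_eq hnd hn)
  obtain ⟨N, h1, -, h2⟩ := OLag.exists_common_transversal h2 hω hnd hn M R' L h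
  exact ⟨N, h1, sup_comm N.space L.space ▸ h2⟩

variable [Fintype F] [DecidableEq F] (hF : ringChar F ≠ 2) (hω : ω.IsAlt) (hnd : ω.Nondegenerate)
  (hn : finrank F V = 2 * n) (hψ : ψ ≠ 1)
include hF hω hnd hn hψ

/-- The scalar in `ansatz_comp` involves only the bases of `L` and `M`, which can be fixed before
`N` is chosen. -/
theorem ansatz_comp_eq_ansatz_comp (L M N N' : OLag ω n)
    (hNL : N.space ⊔ L.space = ⊤) (hMN : M.space ⊔ N.space = ⊤)
    (hNL' : N'.space ⊔ L.space = ⊤) (hMN' : M.space ⊔ N'.space = ⊤) :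
    (ansatz ψ M N).comp (ansatz ψ N L) = (ansatz ψ M N').comp (ansatz ψ N' L) := by
  obtain ⟨r, s, e, g, hrs, heg, hK⟩ :=
    L.isLagrangian.exists_adapted_bases hnd hn M.isLagrangian
  let E : Fin n ≃ Fin r ⊕ Fin s := (finCongr hrs.symm).trans finSumFinEquiv.symm
  rw [ansatz_comp hF hω hnd hn hψ L M N hNL hMN e g E heg hK,
    ansatz_comp hF hω hnd hn hψ L M N' hNL' hMN' e g E heg hK]

theorem ansatz_comp_ansatz (L M N : OLag ω n) (hNL : N.space ⊔ L.space = ⊤)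
    (hMN : M.space ⊔ N.space = ⊤) (hML : M.space ⊔ L.space = ⊤) :
    (ansatz ψ M N).comp (ansatz ψ N L) = ansatz ψ M L := by
  have hd := L.isLagrangian.finrank_eq hnd hn
  -- Transversality of `L` and `M` makes the shared part of the bases empty.
  let r : Fin n ≃ Fin n ⊕ Fin 0 := (Equiv.sumEmpty _ _).symm
  let e := (finBasisOfFinrankEq F L.space hd).reindex r
  let g := (finBasisOfFinrankEq F M.space (M.isLagrangian.finrank_eq hnd hn)).reindex r
  have hbot : L.space ⊓ M.space = ⊥ := by
    rwa [← L.isLagrangian.sup_eq_top_iff hnd hn M.isLagrangian, sup_comm]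
  rw [ansatz_comp hF hω hnd hn hψ L M N hNL hMN e g r (fun k => k.elim0)
    (fun v _ => by rw [hbot]; simp), ansatz, normalization, L.wedgePairing_eq M r e g]
  have hdet : (Matrix.of fun i j => ω (e i) (g j)).det =
      (Matrix.of fun i j => ω (e (Sum.inl i)) (g (Sum.inl j))).det := by
    rw [← Matrix.det_submatrix_equiv_self (Equiv.sumEmpty (Fin n) (Fin 0)).symm]
    rfl
  rw [hdet, div_pow, inv_pow, Fintype.card_fin]
  congr 2
  field_simp

theorem ansatz_comp_ansatz_self (L N : OLag ω n) (h : N.space ⊔ L.space = ⊤) :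
    (ansatz ψ L N).comp (ansatz ψ N L) = Representation.IntertwiningMap.id _ := by
  have hd := L.isLagrangian.finrank_eq hnd hn
  -- Here everything is shared: no Gauss sum remains, and averaging over `L` multiplies by `q ^ n`,
  -- cancelling `q⁻¹ ^ n`.
  let r : Fin n ≃ Fin 0 ⊕ Fin n := (Equiv.emptySum _ _).symm
  let e := (finBasisOfFinrankEq F L.space hd).reindex r
  have hK : ∀ v, (∀ k, ω (e (Sum.inr k)) v = 0) → v ∈ ω.orthogonal (L.space ⊓ L.space) := by
    intro v hv
    rw [inf_idem, L.isLagrangian, L.isLagrangian.mem_iff_basis e]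
    rintro (i | k)
    · exact i.elim0
    · exact hv k
  rw [ansatz_comp hF hω hnd hn hψ L L N h (sup_comm N.space L.space ▸ h) e e r (fun _ => rfl) hK]
  have : Finite V := Module.finite_of_finite F
  have := Fintype.ofFinite L.space
  have hc : Fintype.card L.space = Fintype.card F ^ n := by
    rw [Module.card_eq_pow_finrank (K := F), hd]
  have hsq : (quadraticChar F (L.coeff r e * L.coeff r e) : ℤ) = 1 := by
    rw [← sq, quadraticChar_sq_one' (L.coeff_ne_zero r e)]
  ext f x
  show _ * (averaging ψ L L f).1 x = f.1 x
  rw [averaging_apply, Finset.sum_congr rfl (g := fun _ => f.1 x)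
    (fun (m : L.space) _ => f.2.2 m m.2 x), Finset.sum_const, Finset.card_univ, hc]
  simp only [Matrix.det_isEmpty, mul_one, hsq]
  simp

theorem exists_trivialization :
    ∃ T : ∀ M L : OLag ω n, (modelRep ψ L).IntertwiningMap (modelRep ψ M),
      IsTrivialization T ∧
      ∀ M L : OLag ω n, M.space ⊔ L.space = ⊤ → T M L = ansatz ψ M L := by
  have h2 : (2 : F) ≠ 0 := Ring.two_ne_zero hF
  choose Q hMQ hQL using OLag.exists_transversal (n := n) h2 hω hnd hn
  let T : ∀ M L : OLag ω n, (modelRep ψ L).IntertwiningMap (modelRep ψ M) :=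
    fun M L => (ansatz ψ M (Q M L)).comp (ansatz ψ (Q M L) L)
  have hT : ∀ M L N, M.space ⊔ N.space = ⊤ → N.space ⊔ L.space = ⊤ →
      T M L = (ansatz ψ M N).comp (ansatz ψ N L) := fun M L N h h' =>
    ansatz_comp_eq_ansatz_comp hF hω hnd hn hψ L M _ N (hQL M L) (hMQ M L) h' h
  -- Factor `T P M` through `R` transversal to all three, then contract the pairwise transversal
  -- triple `R`, `M`, `N`.
  have hTa : ∀ P M N, M.space ⊔ N.space = ⊤ → (T P M).comp (ansatz ψ M N) = T P N := by
    intro P M N h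
    obtain ⟨R, hMR, hNR, hPR⟩ := OLag.exists_common_transversal h2 hω hnd hn M N P h
    rw [hT P M R hPR (sup_comm R.space M.space ▸ hMR),
      hT P N R hPR (sup_comm R.space N.space ▸ hNR),
      ← ansatz_comp_ansatz hF hω hnd hn hψ N R M h (sup_comm R.space M.space ▸ hMR)
        (sup_comm R.space N.space ▸ hNR)]
    rfl
  have hcomp : ∀ P M L, (T P M).comp (T M L) = T P L := by
    intro P M L
    -- With `Q` the transversal chosen for `(M, L)`, both sides become `T P M ∘ T_{M,Q} ∘ T_{Q,L}`.
    rw [← hTa P _ L (hQL M L), ← hTa P M _ (hMQ M L)]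
    rfl
  have hid : ∀ L, T L L = Representation.IntertwiningMap.id _ := fun L =>
    ansatz_comp_ansatz_self hF hω hnd hn hψ L _ (hQL L L)
  refine ⟨T, ⟨fun M L => ?_, hcomp⟩, fun M L h =>
    ansatz_comp_ansatz hF hω hnd hn hψ L M _ (hQL M L) (hMQ M L) h⟩
  have hinv : ∀ M L x, T L M (T M L x) = x := fun M L x => by
    rw [← Representation.IntertwiningMap.comp_apply, hcomp, hid]
    rfl
  exact ⟨Function.LeftInverse.injective (hinv M L), Function.RightInverse.surjective (hinv L M)⟩

end Trivialization

end SvN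

end

theorem mainTheorem3 {F V : Type*} [Field F] [Fintype F] [DecidableEq F] (hF : ringChar F ≠ 2)
    [AddCommGroup V] [Module F V] [FiniteDimensional F V]
    (ω : LinearMap.BilinForm F V) (hω : ω.IsAlt) (hnd : ω.Nondegenerate)
    (n : ℕ) (hn : Module.finrank F V = 2 * n)
    (ψ : AddChar F ℂ) (hψ : ψ ≠ 1) :
    ∃! T : ∀ M L : SvN.OLag ω n, (SvN.modelRep ψ L).IntertwiningMap (SvN.modelRep ψ M),
      SvN.IsTrivialization T ∧
      ∀ M L : SvN.OLag ω n, M.space ⊔ L.space = ⊤ → T M L = SvN.ansatz ψ M L := by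
  obtain ⟨T, hT, hTa⟩ := SvN.exists_trivialization (ψ := ψ) hF hω hnd hn hψ
  refine ⟨T, ⟨hT, hTa⟩, fun T' ⟨hT', hTa'⟩ => funext fun M => funext fun L => ?_⟩
  -- Both systems factor through a common transversal, where their values are prescribed.
  obtain ⟨N, hMN, hNL⟩ := SvN.OLag.exists_transversal (Ring.two_ne_zero hF) hω hnd hn M L
  rw [← hT'.comp M N L, ← hT.comp M N L, hTa' M N hMN, hTa' N L hNL, hTa M N hMN, hTa N L hNL]
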